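/- Let $(\Omega,\mathcal G,\mathbb P)$ be a probability space with a filtration $(\mathcal F_t)_{t\ge 0}$ satisfying the usual conditions (right-continuous, and $\mathcal F_0$ contains all $\mathbb P$-null sets), and let $\tau>0$. For a stopping time $S$ write $\mathbb E_S=\mathbb E[\,\cdot\mid\mathcal F_S]$ (conditional expectation of nonnegative random variables, with values in $[0,\infty]$), and let $\|\cdot\|_\infty$ be the essential supremum norm. Let $V=(V_t)_{t\in[0,\tau]}$ be a real-valued adapted process whose paths are almost surely right-continuous with left limits; put $V_{t-}=\lim_{s\uparrow t}V_s$ for $t>0$ and $V_{0-}=V_0$. For $0\le s\le t\le\tau$ define the modulus of mean oscillation $$\rho_{s,t}(V)=\sup_{s\le S\le T\le t}\big\|\mathbb E_S|V_T-V_{S-}|\big\|_\infty ,$$ the supremum being over all stopping times $S,T$ with $s\le S\le T\le t$, and $$\kappa_{s,t}(V)=\lim_{h\downarrow0}\ \sup_{s\le u\le v\le t,\ v-u\le h}\rho_{u,v}(V).$$ Assume that $V$ is of bounded mean oscillation (BMO), i.e. $\rho_{0,\tau}(V)<\infty$. Theorem (John–Nirenberg inequality). For every $r\in[0,\tau]$: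 (i) for every integer $p\ge1$, $$\Big\|\mathbb E_r\sup_{r\le t\le\tau}|V_t-V_r|^p\Big\|_\infty\le p!\,\big(11\,\rho_{r,\tau}(V)\big)^p;$$ (ii) for every real $\lambda<(11\,\kappa_{r,\tau}(V))^{-1}$ (with $0^{-1}=\infty$), $$\Big\|\mathbb E_r\exp\Big(\lambda\sup_{r\le t\le\tau}|V_t-V_r|\Big)\Big\|_\infty<\infty,$$ so in particular $\mathbb E_r\exp\big(\lambda\sup_{r\le t\le\tau}|V_t-V_r|\big)<\infty$ almost surely. -/

import Mathlib

open MeasureTheory Filter Topology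
open scoped NNReal ENNReal

noncomputable section

namespace BMOProcess

variable {Ω : Type*} {m : MeasurableSpace Ω}

/-- The process of left limits `V_{t-}`, with the convention `V_{0-} = V_0`. -/
def leftLimProcess (V : ℝ≥0 → Ω → ℝ) : ℝ≥0 → Ω → ℝ :=
  fun t ω => Function.leftLim (fun s => V s ω) t

/-- The path `x` is right-continuous with left limits on `[0, τ]`. -/
def IsRCLLOn (τ : ℝ≥0) (x : ℝ≥0 → ℝ) : Prop :=
  (∀ t, t < τ → Tendsto x (𝓝[>] t) (𝓝 (x t))) ∧
  (∀ t, 0 < t → t ≤ τ → ∃ l : ℝ, Tendsto x (𝓝[<] t) (𝓝 l))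

/-- The modulus of mean oscillation
`ρ_{s,t}(V) = sup_{s ≤ S ≤ T ≤ t} ‖E_S |V_T - V_{S-}|‖_∞`, the supremum being over all stopping
times `S, T` with `s ≤ S ≤ T ≤ t`. The conditional expectations are those of nonnegative random
variables with respect to `F_S`, with values in `[0, ∞]`. -/
def rho (P : Measure Ω) (F : Filtration ℝ≥0 m) (V : ℝ≥0 → Ω → ℝ) (s t : ℝ≥0) : ℝ≥0∞ :=
  ⨆ (S : Ω → WithTop ℝ≥0) (T : Ω → WithTop ℝ≥0) (hS : IsStoppingTime F S)
    (_ : IsStoppingTime F T) (_ : ∀ ω, (s : WithTop ℝ≥0) ≤ S ω ∧ S ω ≤ T ω ∧ T ω ≤ t),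
    essSup (condLExp hS.measurableSpace P
      (fun ω => ENNReal.ofReal |stoppedValue V T ω - stoppedValue (leftLimProcess V) S ω|)) P

/-- `V` restricted to `[0, τ]` is a BMO process: adapted, with (almost surely) right-continuous
paths with left limits, and `sup_{0 ≤ S ≤ T ≤ τ} ‖E_S |V_T - V_{S-}|‖_∞ < ∞`. -/
structure IsBMO (P : Measure Ω) (F : Filtration ℝ≥0 m) (τ : ℝ≥0) (V : ℝ≥0 → Ω → ℝ) : Prop where
  adapted : ∀ t, t ≤ τ → Measurable[F t] (V t)
  rcll : ∀ᵐ ω ∂P, IsRCLLOn τ (fun t => V t ω)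
  bounded : rho P F V 0 τ < ∞

/-- `sup_{s ≤ u ≤ v ≤ t, v - u ≤ h} ρ_{u,v}(V)`. -/
def rhoScale (P : Measure Ω) (F : Filtration ℝ≥0 m) (V : ℝ≥0 → Ω → ℝ) (s t h : ℝ≥0) : ℝ≥0∞ :=
  ⨆ (u : ℝ≥0) (v : ℝ≥0) (_ : s ≤ u ∧ u ≤ v ∧ v ≤ t ∧ v - u ≤ h), rho P F V u v

/-- `κ_{s,t}(V) = lim_{h ↓ 0} sup_{s ≤ u ≤ v ≤ t, v - u ≤ h} ρ_{u,v}(V)`, written as an infimum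
since the supremum is nondecreasing in `h`; see `tendsto_rhoScale`. -/
def kappa (P : Measure Ω) (F : Filtration ℝ≥0 m) (V : ℝ≥0 → Ω → ℝ) (s t : ℝ≥0) : ℝ≥0∞ :=
  ⨅ (h : ℝ≥0) (_ : 0 < h), rhoScale P F V s t h

theorem rhoScale_mono (P : Measure Ω) (F : Filtration ℝ≥0 m) (V : ℝ≥0 → Ω → ℝ) (s t : ℝ≥0) :
    Monotone (rhoScale P F V s t) := by
  intro h k hk
  refine iSup_mono fun u => iSup_mono fun v => iSup_mono' fun H => ?_
  exact ⟨⟨H.1, H.2.1, H.2.2.1, H.2.2.2.trans hk⟩, le_rfl⟩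

theorem tendsto_rhoScale (P : Measure Ω) (F : Filtration ℝ≥0 m) (V : ℝ≥0 → Ω → ℝ) (s t : ℝ≥0) :
    Tendsto (rhoScale P F V s t) (𝓝[>] 0) (𝓝 (kappa P F V s t)) := by
  have := (rhoScale_mono P F V s t).tendsto_nhdsGT 0
  rw [sInf_image] at this
  exact this

end BMOProcess

end

/-! The argument is a stopping-time form of the John–Nirenberg iteration. Fix `R > 0` with `ρ_{u,v}
≤ R`, start at `T_0 = u`, and let `T_{n+1}` be the first time in `[T_n, v]` at which `V` differs
from `V_{T_n-}` by more than `2R`, with value `⊤` if there is none. At a finite `T_{n+1}` the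
difference is at least `2R`, while its conditional mean given `F_{T_n}` is at most `R`. Markov's
inequality therefore halves the probability at each step, and `P(A, T_n ≠ ⊤) ≤ 2⁻ⁿ P(A)` for every
`A ∈ F_u` (`measure_hitSeq_ne_top_le`).

Measuring from left limits makes jumps harmless: the references `V_{T_n-}` and `V_{T_{n+1}-}` differ
by at most `2R`, since only times before `T_{n+1}` enter. So if `T_n = ⊤`, all of `[u, v]` stays
within `2Rn` of `V_{u-}`, hence within `4Rn` of `V_u`. The oscillation thus has a geometric tail,
and summing with binomial weights gives `p! (8R)^p` as a bound for its conditional `p`-th moment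
(`setLIntegral_maxOsc_pow_le`). The constant 8 is better than the required 11.

The exponential series then converges when `8Rl < 1`. To reach every `l` below the threshold set by
`κ`, the interval `[r, τ]` is cut into finitely many short pieces whose `ρ` is at most such an `R`.
The oscillation is subadditive over pieces, so conditioning successively multiplies finitely many
finite constants (`exists_setLIntegral_expOsc_le`). -/

namespace BMOProcess

variable {Ω : Type*} {m : MeasurableSpace Ω} {P : Measure Ω} {F : Filtration ℝ≥0 m}
  {V : ℝ≥0 → Ω → ℝ} {τ : ℝ≥0}

/-! ### Null sets and completeness -/

section Completeness

theorem measurableSet_of_ae_eq (hcomplete : ∀ N : Set Ω, P N = 0 → MeasurableSet[F 0] N)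
    {t : ℝ≥0} {A B : Set Ω} (hAB : A =ᵐ[P] B) (hB : MeasurableSet[F t] B) :
    MeasurableSet[F t] A := by
  have h := ae_eq_set.1 hAB
  have h1 : MeasurableSet[F t] (A \ B) := F.mono zero_le _ (hcomplete _ h.1)
  have h2 : MeasurableSet[F t] (B \ A) := F.mono zero_le _ (hcomplete _ h.2)
  have : A = (B \ (B \ A)) ∪ (A \ B) := by
    ext ω
    simp only [Set.mem_union, Set.mem_sdiff]
    tauto
  rw [this]
  exact (hB.diff h2).union h1

theorem measurable_of_ae_eq (hcomplete : ∀ N : Set Ω, P N = 0 → MeasurableSet[F 0] N)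
    {β : Type*} [MeasurableSpace β] {t : ℝ≥0} {f g : Ω → β} (hfg : f =ᵐ[P] g)
    (hg : Measurable[F t] g) : Measurable[F t] f := by
  intro s hs
  refine measurableSet_of_ae_eq hcomplete ?_ (hg hs)
  filter_upwards [hfg] with ω hω
  exact propext (by change f ω ∈ s ↔ g ω ∈ s; rw [hω])

theorem measurable_of_ae_tendsto (hcomplete : ∀ N : Set Ω, P N = 0 → MeasurableSet[F 0] N)
    {t : ℝ≥0} {f : ℕ → Ω → ℝ} {g : Ω → ℝ} (hf : ∀ n, Measurable[F t] (f n))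
    (hfg : ∀ᵐ ω ∂P, Tendsto (fun n => f n ω) atTop (𝓝 (g ω))) : Measurable[F t] g := by
  set G : Set Ω := {ω | Tendsto (fun n => f n ω) atTop (𝓝 (g ω))} with hG
  have hGm : MeasurableSet[F t] G := by
    have : MeasurableSet[F t] Gᶜ := F.mono zero_le _ (hcomplete _ hfg)
    simpa using this.compl
  have hlim : Measurable[F t] (G.indicator g) := by
    refine @measurable_of_tendsto_metrizable _ _ (F t) _ _ _ _
      (fun n => G.indicator (f n)) _ (fun n => (hf n).indicator hGm) ?_
    refine tendsto_pi_nhds.2 fun ω => ?_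
    by_cases hω : ω ∈ G
    · simp only [Set.indicator_of_mem hω]
      exact hω
    · simp [Set.indicator_of_notMem hω]
  refine measurable_of_ae_eq hcomplete ?_ hlim
  filter_upwards [hfg] with ω hω
  rw [Set.indicator_of_mem (show ω ∈ G from hω)]

end Completeness

theorem untopA_coe (s : ℝ≥0) : (s : WithTop ℝ≥0).untopA = s := WithTop.untopD_coe _ _

/-! ### Regularity of paths and approximation from the left -/

section Paths

theorem IsRCLLOn.tendsto_leftLim {x : ℝ≥0 → ℝ} (hx : IsRCLLOn τ x) {t : ℝ≥0} (ht : t ≤ τ) :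
    Tendsto x (𝓝[<] t) (𝓝 (Function.leftLim x t)) := by
  rcases eq_or_lt_of_le (zero_le : 0 ≤ t) with rfl | h0
  · have : (Set.Iio (0 : ℝ≥0)) = ∅ := by ext; simp
    rw [this, nhdsWithin_empty]
    exact tendsto_bot
  · exact tendsto_leftLim_of_tendsto (hx.2 t h0 ht)

/-- A right-continuous path visits an open set within `[s, t]` along `t` and a dense set. -/
theorem IsRCLLOn.exists_mem_dense {x : ℝ≥0 → ℝ} (hx : IsRCLLOn τ x) {D : Set ℝ≥0}
    (hD : Dense D) {O : Set ℝ} (hO : IsOpen O) {s t : ℝ≥0} (hst : s ≤ t) (ht : t ≤ τ)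
    (hs : x s ∈ O) : ∃ q ∈ insert t D, s ≤ q ∧ q ≤ t ∧ x q ∈ O := by
  rcases eq_or_lt_of_le hst with rfl | hlt
  · exact ⟨s, Set.mem_insert _ _, le_rfl, le_rfl, hs⟩
  · have h1 : ∀ᶠ q in 𝓝[>] s, x q ∈ O := (hx.1 s (hlt.trans_le ht)).eventually (hO.mem_nhds hs)
    obtain ⟨b, hb, hbO⟩ := (mem_nhdsGT_iff_exists_Ioo_subset' hlt).1 h1
    obtain ⟨q, hqD, hq⟩ := hD.exists_between (lt_min hb hlt)
    exact ⟨q, Set.mem_insert_of_mem _ hqD, hq.1.le, (hq.2.trans_le (min_le_right _ _)).le,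
      hbO ⟨hq.1, hq.2.trans_le (min_le_left _ _)⟩⟩

theorem tendsto_ceil_sub_one_div (s : ℝ≥0) (hs : 0 < s) :
    Tendsto (fun n : ℕ => ((⌈((n : ℝ≥0) + 1) * s⌉₊ - 1 : ℕ) : ℝ≥0) / ((n : ℝ≥0) + 1)) atTop
      (𝓝[<] s) := by
  have hpos : ∀ n : ℕ, (0 : ℝ≥0) < (n : ℝ≥0) + 1 := fun n => by positivity
  have hk : ∀ n : ℕ, ((⌈((n : ℝ≥0) + 1) * s⌉₊ - 1 : ℕ) : ℝ≥0) + 1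
      = ⌈((n : ℝ≥0) + 1) * s⌉₊ := fun n => by
    have : 0 < ⌈((n : ℝ≥0) + 1) * s⌉₊ := Nat.ceil_pos.2 (mul_pos (hpos n) hs)
    exact_mod_cast Nat.sub_add_cancel this
  refine tendsto_nhdsWithin_iff.2 ⟨?_, Eventually.of_forall fun n => ?_⟩
  · rw [← NNReal.tendsto_coe]
    have h0 : Tendsto (fun n : ℕ => (s : ℝ) - 1 / ((n : ℝ) + 1)) atTop (𝓝 ((s : ℝ) - 0)) :=
      tendsto_const_nhds.sub tendsto_one_div_add_atTop_nhds_zero_nat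
    rw [sub_zero] at h0
    refine tendsto_of_tendsto_of_tendsto_of_le_of_le h0 tendsto_const_nhds (fun n => ?_)
      (fun n => ?_)
    · have h2 : ((n : ℝ) + 1) * s ≤ ((⌈((n : ℝ≥0) + 1) * s⌉₊ - 1 : ℕ) : ℝ) + 1 := by
        have := (Nat.le_ceil (((n : ℝ≥0) + 1) * s)).trans_eq (hk n).symm
        exact_mod_cast this
      have hn : (0 : ℝ) < (n : ℝ) + 1 := by positivity
      rw [NNReal.coe_div, NNReal.coe_add, NNReal.coe_natCast, NNReal.coe_natCast, NNReal.coe_one,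
        sub_le_iff_le_add, ← add_div, le_div_iff₀ hn, mul_comm]
      exact h2
    · have h2 : ((⌈((n : ℝ≥0) + 1) * s⌉₊ - 1 : ℕ) : ℝ≥0) < ((n : ℝ≥0) + 1) * s := by
        refine Nat.lt_ceil.1 ?_
        exact Nat.sub_lt (Nat.ceil_pos.2 (mul_pos (hpos n) hs)) one_pos
      refine NNReal.coe_le_coe.2 ((div_le_iff₀' (hpos n)).2 h2.le)
  · have h2 : ((⌈((n : ℝ≥0) + 1) * s⌉₊ - 1 : ℕ) : ℝ≥0) < ((n : ℝ≥0) + 1) * s := by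
      refine Nat.lt_ceil.1 ?_
      exact Nat.sub_lt (Nat.ceil_pos.2 (mul_pos (hpos n) hs)) one_pos
    exact (div_lt_iff₀' (hpos n)).2 h2

end Paths

/-! ### Measurability of left limits, exit times and the running oscillation -/

section Measurability

theorem measurable_apply_nat {α : Type*} [MeasurableSpace α] {N : α → ℕ} (hN : Measurable N)
    (f : ℕ → α → ℝ) (hf : ∀ k, Measurable (f k)) : Measurable fun a => f (N a) a :=
  (measurable_from_prod_countable_right (f := fun p : ℕ × α => f p.1 p.2) hf).comp
    (hN.prodMk measurable_id)

/-- The left limit is approached along grid times strictly before `S`. These take countably many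
values, so only adaptedness at fixed times is needed. The cap at `q` keeps every term `F
q`-measurable. -/
theorem measurable_leftLim_stopped (hcomplete : ∀ N : Set Ω, P N = 0 → MeasurableSet[F 0] N)
    (hadapted : ∀ t, t ≤ τ → Measurable[F t] (V t))
    (hrcll : ∀ᵐ ω ∂P, IsRCLLOn τ (fun t => V t ω)) {S : Ω → WithTop ℝ≥0}
    (hS : IsStoppingTime F S) {q : ℝ≥0} (hq : q ≤ τ) (hSq : ∀ ω, S ω ≤ q) :
    Measurable[F q] (fun ω => leftLimProcess V (S ω).untopA ω) := by
  have hσ : Measurable[F q] fun ω => (S ω).untopA :=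
    (hS.measurable_of_le hSq).untopA
  have hσq : ∀ ω, (S ω).untopA ≤ q := fun ω => WithTop.untopA_le (hSq ω)
  set d : ℕ → ℝ≥0 → ℕ := fun n s => ⌈((n : ℝ≥0) + 1) * s⌉₊ - 1
  have hd : ∀ n, Measurable (d n) := fun n => by
    have h1 : Measurable fun s : ℝ≥0 => ⌈((n : ℝ≥0) + 1) * s⌉₊ :=
      Nat.measurable_ceil.comp (measurable_const.mul measurable_id)
    exact (measurable_of_countable fun k : ℕ => k - 1).comp h1
  refine measurable_of_ae_tendsto hcomplete
    (f := fun n ω => V (min ((d n (S ω).untopA : ℝ≥0) / ((n : ℝ≥0) + 1)) q) ω) (fun n => ?_) ?_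
  · exact @measurable_apply_nat _ (F q) _ ((hd n).comp hσ)
      (fun k ω => V (min ((k : ℝ≥0) / ((n : ℝ≥0) + 1)) q) ω) fun k =>
        (hadapted (min ((k : ℝ≥0) / ((n : ℝ≥0) + 1)) q) ((min_le_right _ _).trans hq)).mono
          (F.mono (min_le_right _ _)) le_rfl
  · filter_upwards [hrcll] with ω hω
    set s := (S ω).untopA with hs
    have hsq : s ≤ q := hσq ω
    rcases eq_or_lt_of_le (zero_le : 0 ≤ s) with h0 | h0
    · have hl : leftLimProcess V s ω = V 0 ω := by
        rw [← h0]
        exact leftLim_eq_of_isBot (f := fun t => V t ω) (fun b => zero_le)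
      -- Truncated subtraction gives grid time 0 at `s = 0`, which matches `V_{0-} = V_0`.
      have : ∀ n, d n s = 0 := fun n => by simp [d, ← h0]
      simp only [this, hl]
      simp
    · refine (hω.tendsto_leftLim (hsq.trans hq)).comp ?_
      refine (tendsto_ceil_sub_one_div s h0).congr' ?_
      have h3 := (tendsto_ceil_sub_one_div s h0).eventually (eventually_mem_nhdsWithin)
      filter_upwards [h3] with n hn
      exact (min_eq_left ((le_of_lt hn).trans hsq)).symm

theorem measurableSet_lt_abs_sub_leftLim
    (hcomplete : ∀ N : Set Ω, P N = 0 → MeasurableSet[F 0] N)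
    (hadapted : ∀ t, t ≤ τ → Measurable[F t] (V t))
    (hrcll : ∀ᵐ ω ∂P, IsRCLLOn τ (fun t => V t ω)) {S : Ω → WithTop ℝ≥0}
    (hS : IsStoppingTime F S) {q : ℝ≥0} (hq : q ≤ τ) (c : ℝ) :
    MeasurableSet[F q]
      {ω | S ω ≤ q ∧ c < |V q ω - leftLimProcess V (S ω).untopA ω|} := by
  have h1 := measurable_leftLim_stopped hcomplete hadapted hrcll (hS.min_const q) hq
    (fun ω => min_le_right _ _)
  have h2 : Measurable[F q] fun ω =>
      |V q ω - leftLimProcess V (min (S ω) (q : WithTop ℝ≥0)).untopA ω| :=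
    measurable_norm.comp ((hadapted q hq).sub h1)
  have h3 : {ω | S ω ≤ q ∧ c < |V q ω - leftLimProcess V (S ω).untopA ω|}
      = {ω | S ω ≤ q} ∩ {ω | c < |V q ω -
        leftLimProcess V (min (S ω) (q : WithTop ℝ≥0)).untopA ω|} := by
    ext ω
    simp only [Set.mem_ofPred_eq, Set.mem_inter_iff]
    refine and_congr_right fun h => ?_
    rw [min_eq_left h]
  rw [h3]
  exact (hS q).inter (h2 measurableSet_Ioi)

/-- The first time `t ≥ S` with `t ≤ v` and `|V_t - V_{S-}| > c`, and `⊤` if there is none. -/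
noncomputable def nextHit (V : ℝ≥0 → Ω → ℝ) (c : ℝ) (v : ℝ≥0) (S : Ω → WithTop ℝ≥0) :
    Ω → WithTop ℝ≥0 := fun ω =>
  sInf ((fun t : ℝ≥0 => (t : WithTop ℝ≥0)) ''
    {t | S ω ≤ t ∧ t ≤ v ∧ c < |V t ω - leftLimProcess V (S ω).untopA ω|})

theorem nextHit_lt_iff {c : ℝ} {v : ℝ≥0} {S : Ω → WithTop ℝ≥0} {ω : Ω} {a : WithTop ℝ≥0} :
    nextHit V c v S ω < a ↔ ∃ t : ℝ≥0, S ω ≤ t ∧ t ≤ v ∧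
      c < |V t ω - leftLimProcess V (S ω).untopA ω| ∧ (t : WithTop ℝ≥0) < a := by
  simp only [nextHit, sInf_lt_iff, Set.mem_image, Set.mem_ofPred_eq]
  constructor
  · rintro ⟨_, ⟨t, ht, rfl⟩, hta⟩
    exact ⟨t, ht.1, ht.2.1, ht.2.2, hta⟩
  · rintro ⟨t, h1, h2, h3, h4⟩
    exact ⟨_, ⟨t, ⟨h1, h2, h3⟩, rfl⟩, h4⟩

theorem le_nextHit {c : ℝ} {v : ℝ≥0} {S : Ω → WithTop ℝ≥0} (ω : Ω) :
    S ω ≤ nextHit V c v S ω := by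
  refine le_sInf ?_
  rintro _ ⟨t, ht, rfl⟩
  exact ht.1

theorem nextHit_le {c : ℝ} {v : ℝ≥0} {S : Ω → WithTop ℝ≥0} {ω : Ω} {t : ℝ≥0}
    (hSt : S ω ≤ t) (htv : t ≤ v) (ht : c < |V t ω - leftLimProcess V (S ω).untopA ω|) :
    nextHit V c v S ω ≤ t :=
  sInf_le ⟨t, ⟨hSt, htv, ht⟩, rfl⟩

theorem abs_sub_le_of_lt_nextHit {c : ℝ} {v : ℝ≥0} {S : Ω → WithTop ℝ≥0} {ω : Ω} {t : ℝ≥0}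
    (hSt : S ω ≤ t) (htv : t ≤ v) (ht : t < nextHit V c v S ω) :
    |V t ω - leftLimProcess V (S ω).untopA ω| ≤ c := by
  by_contra! h
  exact not_le.2 ht (nextHit_le hSt htv h)

theorem nextHit_le_of_ne_top {c : ℝ} {v : ℝ≥0} {S : Ω → WithTop ℝ≥0} {ω : Ω}
    (h : nextHit V c v S ω ≠ ⊤) : nextHit V c v S ω ≤ v := by
  obtain ⟨t, h1, h2, h3, -⟩ := nextHit_lt_iff.1 (lt_top_iff_ne_top.2 h)
  exact (nextHit_le h1 h2 h3).trans (WithTop.coe_le_coe.2 h2)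

/-- If the difference were below `c` at the infimum, right-continuity would keep it below `c` just
afterwards, against the definition of the infimum. Only the weak inequality survives, since the
infimum need not be attained. -/
theorem le_abs_sub_of_nextHit_ne_top {c : ℝ} {v : ℝ≥0} (hv : v ≤ τ) {S : Ω → WithTop ℝ≥0}
    {ω : Ω} (hω : IsRCLLOn τ (fun t => V t ω)) (h : nextHit V c v S ω ≠ ⊤) :
    c ≤ |V (nextHit V c v S ω).untopA ω - leftLimProcess V (S ω).untopA ω| := by
  set b := leftLimProcess V (S ω).untopA ω with hb
  have hle := nextHit_le_of_ne_top h
  obtain ⟨s, hs⟩ := WithTop.ne_top_iff_exists.1 h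
  have hsv : s ≤ v := by rw [← hs] at hle; exact WithTop.coe_le_coe.1 hle
  rw [← hs, untopA_coe]
  by_contra! hlt
  have hge : ∀ t : ℝ≥0, S ω ≤ t → t ≤ v → c < |V t ω - b| → s ≤ t := fun t h1 h2 h3 => by
    have : nextHit V c v S ω ≤ t := nextHit_le h1 h2 h3
    rw [← hs] at this
    exact WithTop.coe_le_coe.1 this
  have hne : ∀ t : ℝ≥0, S ω ≤ t → t ≤ v → c < |V t ω - b| → s < t := fun t h1 h2 h3 => by
    refine lt_of_le_of_ne (hge t h1 h2 h3) ?_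
    rintro rfl
    exact lt_asymm hlt h3
  obtain ⟨t₀, h1, h2, h3, -⟩ := nextHit_lt_iff.1 (lt_top_iff_ne_top.2 h)
  have hst₀ := hne t₀ h1 h2 h3
  have hO : IsOpen {y : ℝ | |y - b| < c} :=
    isOpen_lt ((continuous_id.sub continuous_const).abs) continuous_const
  have hev : ∀ᶠ t in 𝓝[>] s, |V t ω - b| < c :=
    (hω.1 s (hst₀.trans_le (h2.trans hv))).eventually (hO.mem_nhds hlt)
  obtain ⟨e, he, heO⟩ := (mem_nhdsGT_iff_exists_Ioo_subset' hst₀).1 hev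
  obtain ⟨t, h1, h2, h3, h4⟩ := nextHit_lt_iff.1
    (show nextHit V c v S ω < (e : WithTop ℝ≥0) by rw [← hs]; exact WithTop.coe_lt_coe.2 he)
  exact lt_asymm h3 (heO ⟨hne t h1 h2 h3, WithTop.coe_lt_coe.1 h4⟩)

/-- By right-continuity of paths, crossing before `t` is detected on a countable dense set, up to a
null set that completeness absorbs. The endpoint `v` is added because a crossing at `v` alone has no
later witness. Right-continuity of the filtration makes the strict events `{T < t}` sufficient. -/
theorem isStoppingTime_nextHit [F.IsRightContinuous]
    (hcomplete : ∀ N : Set Ω, P N = 0 → MeasurableSet[F 0] N)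
    (hadapted : ∀ t, t ≤ τ → Measurable[F t] (V t))
    (hrcll : ∀ᵐ ω ∂P, IsRCLLOn τ (fun t => V t ω)) {S : Ω → WithTop ℝ≥0}
    (hS : IsStoppingTime F S) {v : ℝ≥0} (hv : v ≤ τ) (c : ℝ) :
    IsStoppingTime F (nextHit V c v S) := by
  refine isStoppingTime_of_measurableSet_lt_of_isRightContinuous fun t => ?_
  obtain ⟨D, hDc, hD⟩ := TopologicalSpace.exists_countable_dense ℝ≥0
  refine measurableSet_of_ae_eq hcomplete (B := ⋃ q ∈ {q | q ∈ insert v D ∧ q ≤ v ∧ q < t},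
    {ω | S ω ≤ q ∧ c < |V q ω - leftLimProcess V (S ω).untopA ω|}) ?_ ?_
  · filter_upwards [hrcll] with ω hω
    refine propext ?_
    change nextHit V c v S ω < t ↔ ω ∈ (⋃ q ∈ {q | q ∈ insert v D ∧ q ≤ v ∧ q < t},
      {ω | S ω ≤ q ∧ c < |V q ω - leftLimProcess V (S ω).untopA ω|})
    rw [nextHit_lt_iff]
    simp only [Set.mem_iUnion, Set.mem_ofPred_eq, exists_prop]
    constructor
    · rintro ⟨s, h1, h2, h3, h4⟩
      rcases eq_or_lt_of_le h2 with rfl | hlt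
      · exact ⟨s, ⟨Set.mem_insert _ _, le_rfl, WithTop.coe_lt_coe.1 h4⟩, h1, h3⟩
      · have hO : IsOpen {y : ℝ | c < |y - leftLimProcess V (S ω).untopA ω|} :=
          isOpen_lt continuous_const ((continuous_id.sub continuous_const).abs)
        obtain ⟨b, hsb, hb⟩ := exists_between (lt_min hlt (WithTop.coe_lt_coe.1 h4))
        have hev : ∀ᶠ q in 𝓝[>] s, c < |V q ω - leftLimProcess V (S ω).untopA ω| :=
          (hω.1 s (hlt.trans_le hv)).eventually (hO.mem_nhds h3)
        obtain ⟨e, he, heO⟩ := (mem_nhdsGT_iff_exists_Ioo_subset' hsb).1 hev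
        obtain ⟨q, hqD, hq⟩ := hD.exists_between (lt_min he hsb)
        have hqb : q < b := hq.2.trans_le (min_le_right _ _)
        exact ⟨q, ⟨Set.mem_insert_of_mem _ hqD, (hqb.trans (hb.trans_le (min_le_left _ _))).le,
          hqb.trans (hb.trans_le (min_le_right _ _))⟩,
          h1.trans (WithTop.coe_le_coe.2 hq.1.le), heO ⟨hq.1, hq.2.trans_le (min_le_left _ _)⟩⟩
    · rintro ⟨q, ⟨-, h1, h2⟩, h3, h4⟩
      exact ⟨q, h3, h1, h4, WithTop.coe_lt_coe.2 h2⟩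
  · refine MeasurableSet.biUnion ((hDc.insert v).mono fun q hq => hq.1) fun q hq => ?_
    exact F.mono hq.2.2.le _
      (measurableSet_lt_abs_sub_leftLim hcomplete hadapted hrcll hS (hq.2.1.trans hv) c)

/-- The running oscillation `sup_{u ≤ t ≤ v} |V_t - V_u|`. -/
noncomputable def maxOsc (V : ℝ≥0 → Ω → ℝ) (u v : ℝ≥0) (ω : Ω) : ℝ≥0∞ :=
  ⨆ t ∈ Set.Icc u v, ENNReal.ofReal |V t ω - V u ω|

theorem measurable_maxOsc (hcomplete : ∀ N : Set Ω, P N = 0 → MeasurableSet[F 0] N)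
    (hadapted : ∀ t, t ≤ τ → Measurable[F t] (V t))
    (hrcll : ∀ᵐ ω ∂P, IsRCLLOn τ (fun t => V t ω)) {u v : ℝ≥0} (hv : v ≤ τ) :
    Measurable[F v] (maxOsc V u v) := by
  obtain ⟨D, hDc, hD⟩ := TopologicalSpace.exists_countable_dense ℝ≥0
  refine measurable_of_ae_eq hcomplete
    (g := fun ω => ⨆ t ∈ insert v D ∩ Set.Icc u v, ENNReal.ofReal |V t ω - V u ω|) ?_ ?_
  · filter_upwards [hrcll] with ω hω
    refine le_antisymm (iSup₂_le fun t ht => le_of_forall_lt fun b hb => ?_)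
      (iSup₂_le fun t ht => le_iSup₂_of_le t ht.2 le_rfl)
    have hO : IsOpen {y : ℝ | b < ENNReal.ofReal |y - V u ω|} :=
      isOpen_lt continuous_const
        (ENNReal.continuous_ofReal.comp (continuous_id.sub continuous_const).abs)
    obtain ⟨q, hq, h1, h2, h3⟩ := hω.exists_mem_dense hD hO ht.2 hv hb
    exact lt_of_lt_of_le h3 (le_iSup₂_of_le (f := fun t _ => ENNReal.ofReal |V t ω - V u ω|)
      q ⟨hq, ht.1.trans h1, h2⟩ le_rfl)
  · refine Measurable.biSup _ ((hDc.insert v).mono Set.inter_subset_left) fun t ht => ?_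
    have h1 : Measurable[F v] (V t) :=
      (hadapted t (ht.2.2.trans hv)).mono (F.mono ht.2.2) le_rfl
    have h2 : Measurable[F v] (V u) :=
      (hadapted u ((ht.2.1.trans ht.2.2).trans hv)).mono (F.mono (ht.2.1.trans ht.2.2)) le_rfl
    exact ENNReal.measurable_ofReal.comp (measurable_norm.comp (h1.sub h2))

end Measurability

/-! ### Iterated exit times and geometric decay -/

theorem setLIntegral_abs_sub_le_rho [IsFiniteMeasure P] {s t : ℝ≥0} {S T : Ω → WithTop ℝ≥0}
    (hS : IsStoppingTime F S) (hT : IsStoppingTime F T)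
    (hST : ∀ ω, (s : WithTop ℝ≥0) ≤ S ω ∧ S ω ≤ T ω ∧ T ω ≤ t) {A : Set Ω}
    (hA : MeasurableSet[hS.measurableSpace] A) :
    ∫⁻ ω in A, ENNReal.ofReal |V (T ω).untopA ω - leftLimProcess V (S ω).untopA ω| ∂P
      ≤ rho P F V s t * P A := by
  have hle := hS.measurableSpace_le
  change ∫⁻ ω in A, ENNReal.ofReal |stoppedValue V T ω - stoppedValue (leftLimProcess V) S ω| ∂P
    ≤ _
  rw [← setLIntegral_condLExp hle P _ hA, ← setLIntegral_const]
  refine lintegral_mono_ae (ae_restrict_of_ae ?_)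
  filter_upwards [ENNReal.ae_le_essSup (μ := P) (condLExp hS.measurableSpace P (fun ω =>
    ENNReal.ofReal |stoppedValue V T ω - stoppedValue (leftLimProcess V) S ω|))] with ω hω
  refine hω.trans ?_
  exact le_iSup_of_le S (le_iSup_of_le T (le_iSup_of_le hS (le_iSup_of_le hT
    (le_iSup_of_le hST le_rfl))))

/-- The successive times, started at `u`, at which `V` has moved by more than `c` away from its
left limit at the previous time. -/
noncomputable def hitSeq (V : ℝ≥0 → Ω → ℝ) (c : ℝ) (u v : ℝ≥0) : ℕ → Ω → WithTop ℝ≥0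
  | 0 => fun _ => u
  | n + 1 => nextHit V c v (hitSeq V c u v n)

theorem le_hitSeq {c : ℝ} {u v : ℝ≥0} (n : ℕ) (ω : Ω) : u ≤ hitSeq V c u v n ω := by
  induction n with
  | zero => exact le_rfl
  | succ n ih => exact ih.trans (le_nextHit ω)

theorem hitSeq_le_of_ne_top {c : ℝ} {u v : ℝ≥0} (huv : u ≤ v) {n : ℕ} {ω : Ω}
    (h : hitSeq V c u v n ω ≠ ⊤) : hitSeq V c u v n ω ≤ v := by
  cases n with
  | zero => exact WithTop.coe_le_coe.2 huv
  | succ n => exact nextHit_le_of_ne_top h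

theorem hitSeq_ne_top_iff {c : ℝ} {u v : ℝ≥0} (huv : u ≤ v) {n : ℕ} {ω : Ω} :
    hitSeq V c u v n ω ≠ ⊤ ↔ hitSeq V c u v n ω ≤ v :=
  ⟨hitSeq_le_of_ne_top huv, fun h => ne_top_of_le_ne_top WithTop.coe_ne_top h⟩

theorem hitSeq_ne_top_of_succ {c : ℝ} {u v : ℝ≥0} {n : ℕ} {ω : Ω}
    (h : hitSeq V c u v (n + 1) ω ≠ ⊤) : hitSeq V c u v n ω ≠ ⊤ :=
  ne_top_of_le_ne_top h (le_nextHit ω)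

theorem isStoppingTime_hitSeq [F.IsRightContinuous]
    (hcomplete : ∀ N : Set Ω, P N = 0 → MeasurableSet[F 0] N)
    (hadapted : ∀ t, t ≤ τ → Measurable[F t] (V t))
    (hrcll : ∀ᵐ ω ∂P, IsRCLLOn τ (fun t => V t ω)) {u v : ℝ≥0} (hv : v ≤ τ) (c : ℝ) (n : ℕ) :
    IsStoppingTime F (hitSeq V c u v n) := by
  induction n with
  | zero => exact isStoppingTime_const F u
  | succ n ih => exact isStoppingTime_nextHit hcomplete hadapted hrcll ih hv c

/-- Between consecutive times the path is within `c` of the current left limit. Letting `t` increase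
to the next time gives the same bound between the two left limits, so each step costs `c` whatever
the jump at the new time. -/
theorem abs_sub_le_of_lt_hitSeq {c : ℝ} (hc0 : 0 ≤ c) {u v : ℝ≥0} (huv : u ≤ v) (hv : v ≤ τ)
    {ω : Ω}
    (hω : IsRCLLOn τ (fun t => V t ω)) (n : ℕ) :
    (∀ t : ℝ≥0, u ≤ t → t ≤ v → t < hitSeq V c u v n ω →
      |V t ω - leftLimProcess V u ω| ≤ n * c) ∧
    (hitSeq V c u v n ω ≠ ⊤ →
      |(leftLimProcess V (hitSeq V c u v n ω).untopA ω) - leftLimProcess V u ω| ≤ n * c) := by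
  induction n with
  | zero =>
    refine ⟨fun t h1 _ h3 => absurd (WithTop.coe_lt_coe.1 h3) (not_lt.2 h1), fun _ => ?_⟩
    change |(leftLimProcess V (u : WithTop ℝ≥0).untopA ω) - leftLimProcess V u ω| ≤ _
    rw [untopA_coe]
    simp
  | succ n ih =>
    have htri : ∀ a b e : ℝ, |a - b| ≤ c → |b - e| ≤ n * c → |a - e| ≤ (n + 1 : ℕ) * c := by
      intro a b e h1 h2
      have := abs_sub_le a b e
      push_cast
      linarith
    have hc : ∀ t : ℝ≥0, u ≤ t → t ≤ v → hitSeq V c u v n ω ≤ t →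
        t < hitSeq V c u v (n + 1) ω →
        |V t ω - leftLimProcess V (hitSeq V c u v n ω).untopA ω| ≤ c :=
      fun t _ h2 h3 h4 => abs_sub_le_of_lt_nextHit h3 h2 h4
    have hmono : (n : ℝ) * c ≤ (n + 1 : ℕ) * c := by
      push_cast
      nlinarith
    refine ⟨fun t h1 h2 h3 => ?_, fun h => ?_⟩
    · rcases lt_or_ge (t : WithTop ℝ≥0) (hitSeq V c u v n ω) with hlt | hge
      · exact (ih.1 t h1 h2 hlt).trans hmono
      · exact htri _ _ _ (hc t h1 h2 hge h3) (ih.2 (ne_top_of_le_ne_top WithTop.coe_ne_top hge))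
    · have hn := hitSeq_ne_top_of_succ h
      have hle : hitSeq V c u v n ω ≤ hitSeq V c u v (n + 1) ω := le_nextHit ω
      have hbv := hitSeq_le_of_ne_top huv h
      have hau := le_hitSeq (V := V) (c := c) (u := u) (v := v) n ω
      have ih2 := ih.2 hn
      obtain ⟨a, ha⟩ := WithTop.ne_top_iff_exists.1 hn
      obtain ⟨b, hb⟩ := WithTop.ne_top_iff_exists.1 h
      rw [← ha, ← hb] at hle
      rw [← hb] at hbv hc ⊢
      rw [← ha] at hc ih2 hau
      simp only [untopA_coe] at hc ih2 ⊢
      rw [WithTop.coe_le_coe] at hle hbv hau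
      rcases eq_or_lt_of_le hle with rfl | hlt
      · exact ih2.trans hmono
      · refine htri _ _ _ ?_ ih2
        have hne : (𝓝[<] b).NeBot := nhdsLT_neBot_of_exists_lt ⟨a, hlt⟩
        have hlim := hω.tendsto_leftLim (hbv.trans hv)
        refine le_of_tendsto (hlim.sub_const (leftLimProcess V a ω)).abs ?_
        filter_upwards [Ioo_mem_nhdsLT hlt] with t ht
        exact hc t (hau.trans ht.1.le) (ht.2.le.trans hbv) (WithTop.coe_le_coe.2 ht.1.le)
          (WithTop.coe_lt_coe.2 ht.2)

theorem measure_hitSeq_ne_top_le [IsFiniteMeasure P] [F.IsRightContinuous]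
    (hcomplete : ∀ N : Set Ω, P N = 0 → MeasurableSet[F 0] N)
    (hadapted : ∀ t, t ≤ τ → Measurable[F t] (V t))
    (hrcll : ∀ᵐ ω ∂P, IsRCLLOn τ (fun t => V t ω)) {u v : ℝ≥0} (huv : u ≤ v) (hv : v ≤ τ)
    {R : ℝ} (hR : 0 < R) (hrho : rho P F V u v ≤ ENNReal.ofReal R) {A : Set Ω}
    (hA : MeasurableSet[F u] A) (n : ℕ) :
    P (A ∩ {ω | hitSeq V (2 * R) u v n ω ≠ ⊤}) ≤ 2⁻¹ ^ n * P A := by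
  induction n with
  | zero => simpa using measure_mono Set.inter_subset_left
  | succ n ih =>
    set S := hitSeq V (2 * R) u v n with hSdef
    have hS : IsStoppingTime F S := isStoppingTime_hitSeq hcomplete hadapted hrcll hv _ n
    have hT : IsStoppingTime F (hitSeq V (2 * R) u v (n + 1)) :=
      isStoppingTime_hitSeq hcomplete hadapted hrcll hv _ (n + 1)
    set T := hitSeq V (2 * R) u v (n + 1) with hTdef
    have hBS : {ω | S ω ≠ ⊤} = {ω | S ω ≤ v} := Set.ext fun ω => hitSeq_ne_top_iff huv
    have hBT : {ω | T ω ≠ ⊤} = {ω | T ω ≤ v} := Set.ext fun ω => hitSeq_ne_top_iff huv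
    have hAv : MeasurableSet[F v] A := F.mono huv _ hA
    have hmS : MeasurableSet[(hS.min_const v).measurableSpace] (A ∩ {ω | S ω ≠ ⊤}) := by
      rw [IsStoppingTime.measurableSet_min_const_iff, hBS]
      refine ⟨?_, hAv.inter (hS v)⟩
      exact (hS.le_measurableSpace_of_const_le (fun ω => le_hitSeq n ω) _ hA).inter
        (hS.measurableSet_le' v)
    have hmT : MeasurableSet (A ∩ {ω | T ω ≠ ⊤}) := by
      rw [hBT]
      exact F.le v _ (hAv.inter (hT v))
    have hle : ∀ ω, (u : WithTop ℝ≥0) ≤ min (S ω) v ∧ min (S ω) v ≤ min (T ω) v ∧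
        min (T ω) v ≤ v := fun ω =>
      ⟨le_min (le_hitSeq n ω) (WithTop.coe_le_coe.2 huv),
        min_le_min_right _ (le_nextHit ω), min_le_right _ _⟩
    -- Cutting both times at `v` brings them into the range of `ρ_{u,v}`; on `{T ≠ ⊤}` the cut
    -- changes nothing.
    have hosc := (setLIntegral_abs_sub_le_rho (P := P) (V := V) (hS.min_const v) (hT.min_const v)
      hle hmS).trans (mul_le_mul_left hrho _)
    have hmarkov : ENNReal.ofReal (2 * R) * P (A ∩ {ω | T ω ≠ ⊤}) ≤
        ENNReal.ofReal R * P (A ∩ {ω | S ω ≠ ⊤}) := by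
      refine le_trans ?_ hosc
      rw [← setLIntegral_const]
      refine le_trans ?_ (lintegral_mono_set
        (Set.inter_subset_inter_right A fun ω hω => hitSeq_ne_top_of_succ hω))
      refine lintegral_mono_ae ?_
      filter_upwards [ae_restrict_of_ae hrcll, ae_restrict_mem hmT] with ω hω hωT
      have hTv : T ω ≤ v := hitSeq_le_of_ne_top huv hωT.2
      rw [min_eq_left hTv, min_eq_left ((le_nextHit ω).trans hTv)]
      exact ENNReal.ofReal_le_ofReal (le_abs_sub_of_nextHit_ne_top hv hω hωT.2)
    rw [ENNReal.ofReal_mul zero_le_two, mul_comm (ENNReal.ofReal 2), mul_assoc,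
      ENNReal.mul_le_mul_iff_right (by simpa using hR) ENNReal.ofReal_ne_top,
      ENNReal.ofReal_ofNat] at hmarkov
    calc P (A ∩ {ω | T ω ≠ ⊤}) = 2⁻¹ * (2 * P (A ∩ {ω | T ω ≠ ⊤})) := by
          rw [← mul_assoc, ENNReal.inv_mul_cancel two_ne_zero ENNReal.ofNat_ne_top, one_mul]
      _ ≤ 2⁻¹ * (2⁻¹ ^ n * P A) := mul_le_mul_right (hmarkov.trans ih) _
      _ = 2⁻¹ ^ (n + 1) * P A := by rw [pow_succ']; ring

/-! ### Moments of the running oscillation -/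

/-- By the hockey-stick identity the right side is `n (n+1) ⋯ (n+p)`. Binomial weights are used
because their geometric sum is explicit and produces exactly the factor `p!`. -/
theorem pow_succ_le_sum_choose (n p : ℕ) :
    n ^ (p + 1) ≤ (p + 1).factorial * ∑ k ∈ Finset.range n, (k + p).choose p := by
  have hsum : ∀ n : ℕ, ∑ k ∈ Finset.range n, (k + p).choose p = (n + p).choose (p + 1) := by
    intro n
    induction n with
    | zero => simp
    | succ n ih =>
      rw [Finset.sum_range_succ, ih, show n + 1 + p = (n + p) + 1 by ring,
        Nat.choose_succ_succ, add_comm]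
  rw [hsum]
  have h := Nat.pow_succ_le_ascFactorial n (p + 1)
  rwa [Nat.ascFactorial_eq_factorial_mul_choose'] at h

theorem tsum_choose_mul_half_pow (p : ℕ) :
    ∑' k : ℕ, ((k + p).choose p : ℝ≥0∞) * 2⁻¹ ^ k = 2 ^ (p + 1) := by
  have h := hasSum_choose_mul_geometric_of_norm_lt_one (𝕜 := ℝ) p (r := 2⁻¹) (by norm_num)
  have h2 : (1 : ℝ) / (1 - 2⁻¹) ^ (p + 1) = 2 ^ (p + 1) := by
    rw [one_div, ← inv_pow]
    norm_num
  rw [h2] at h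
  have h3 := ENNReal.ofReal_tsum_of_nonneg (fun n => by positivity) h.summable
  rw [h.tsum_eq] at h3
  rw [ENNReal.ofReal_pow zero_le_two, ENNReal.ofReal_ofNat] at h3
  rw [h3]
  refine tsum_congr fun k => ?_
  rw [ENNReal.ofReal_mul (by positivity), ENNReal.ofReal_natCast,
    ENNReal.ofReal_pow (by positivity), ENNReal.ofReal_inv_of_pos two_pos, ENNReal.ofReal_ofNat]

/-- If `n` is the first index with `T_n = ⊤`, the oscillation is at most `4Rn` and the indicators
for `k < n` are 1. The series then dominates the partial sum in `pow_succ_le_sum_choose`. -/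
theorem maxOsc_pow_le {R : ℝ} (hR : 0 < R) {u v : ℝ≥0} (huv : u ≤ v) (hv : v ≤ τ) {ω : Ω}
    (hω : IsRCLLOn τ (fun t => V t ω)) (p : ℕ) :
    maxOsc V u v ω ^ (p + 1) ≤ ((p + 1).factorial : ℝ≥0∞) * ENNReal.ofReal (4 * R) ^ (p + 1) *
      ∑' k : ℕ, ((k + p).choose p : ℝ≥0∞) *
        {ω | hitSeq V (2 * R) u v k ω ≠ ⊤}.indicator 1 ω := by
  by_cases hex : ∃ n, hitSeq V (2 * R) u v n ω = ⊤
  · classical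
    set n := Nat.find hex with hn
    have htop : hitSeq V (2 * R) u v n ω = ⊤ := Nat.find_spec hex
    have hM : maxOsc V u v ω ≤ (n : ℝ≥0∞) * ENNReal.ofReal (4 * R) := by
      refine iSup₂_le fun t ht => ?_
      rw [← ENNReal.ofReal_natCast n, ← ENNReal.ofReal_mul (Nat.cast_nonneg n)]
      refine ENNReal.ofReal_le_ofReal ?_
      have h := (abs_sub_le_of_lt_hitSeq (c := 2 * R) (by positivity) huv hv hω n).1
      -- The bound `2Rn` to `V_{u-}` is used at `t` and at `u`, since `V` may jump at `u`; this
      -- doubles the constant.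
      have h1 := h t ht.1 ht.2 (by rw [htop]; exact WithTop.coe_lt_top t)
      have h2 := h u le_rfl huv (by rw [htop]; exact WithTop.coe_lt_top u)
      have h3 := abs_sub_le (V t ω) (leftLimProcess V u ω) (V u ω)
      rw [abs_sub_comm (leftLimProcess V u ω)] at h3
      linarith
    have hS : (∑ k ∈ Finset.range n, ((k + p).choose p : ℝ≥0∞)) ≤
        ∑' k : ℕ, ((k + p).choose p : ℝ≥0∞) *
          {ω | hitSeq V (2 * R) u v k ω ≠ ⊤}.indicator 1 ω := by
      refine le_trans (Finset.sum_le_sum fun k hk => ?_) (ENNReal.sum_le_tsum (Finset.range n))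
      have hk' : ω ∈ {ω | hitSeq V (2 * R) u v k ω ≠ ⊤} :=
        Nat.find_min hex (Finset.mem_range.1 hk)
      rw [Set.indicator_of_mem hk', Pi.one_apply, mul_one]
    have hpow : (n : ℝ≥0∞) ^ (p + 1) ≤
        ((p + 1).factorial : ℝ≥0∞) * ∑ k ∈ Finset.range n, ((k + p).choose p : ℝ≥0∞) := by
      exact_mod_cast pow_succ_le_sum_choose n p
    calc maxOsc V u v ω ^ (p + 1) ≤ ((n : ℝ≥0∞) * ENNReal.ofReal (4 * R)) ^ (p + 1) := by gcongr
      _ = (n : ℝ≥0∞) ^ (p + 1) * ENNReal.ofReal (4 * R) ^ (p + 1) := mul_pow _ _ _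
      _ ≤ _ := by
        refine (mul_le_mul_left hpow _).trans ?_
        rw [mul_right_comm]
        exact mul_le_mul_right hS _
  -- If no `T_n` is `⊤` (for example the times stall at a jump larger than `2R`), every indicator is
  -- 1 and the bound is infinite.
  · push Not at hex
    have htop : ∑' k : ℕ, ((k + p).choose p : ℝ≥0∞) *
        {ω | hitSeq V (2 * R) u v k ω ≠ ⊤}.indicator 1 ω = ⊤ := by
      refine top_unique ?_
      rw [← ENNReal.tsum_const_eq_top_of_ne_zero (α := ℕ) one_ne_zero]
      refine ENNReal.tsum_le_tsum fun k => ?_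
      have hk : ω ∈ {ω | hitSeq V (2 * R) u v k ω ≠ ⊤} := hex k
      rw [Set.indicator_of_mem hk, Pi.one_apply, mul_one]
      exact_mod_cast Nat.choose_pos (Nat.le_add_left p k)
    rw [htop, ENNReal.mul_top]
    · exact le_top
    · refine mul_ne_zero (by exact_mod_cast (p + 1).factorial_ne_zero) (pow_ne_zero _ ?_)
      simpa using hR

theorem setLIntegral_maxOsc_pow_le [IsFiniteMeasure P] [F.IsRightContinuous]
    (hcomplete : ∀ N : Set Ω, P N = 0 → MeasurableSet[F 0] N)
    (hadapted : ∀ t, t ≤ τ → Measurable[F t] (V t))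
    (hrcll : ∀ᵐ ω ∂P, IsRCLLOn τ (fun t => V t ω)) {u v : ℝ≥0} (huv : u ≤ v) (hv : v ≤ τ)
    {R : ℝ} (hR : 0 < R) (hrho : rho P F V u v ≤ ENNReal.ofReal R) {A : Set Ω}
    (hA : MeasurableSet[F u] A) (p : ℕ) :
    ∫⁻ ω in A, maxOsc V u v ω ^ p ∂P
      ≤ (p.factorial : ℝ≥0∞) * ENNReal.ofReal (8 * R) ^ p * P A := by
  cases p with
  | zero => simp
  | succ p =>
    have hB : ∀ k, MeasurableSet {ω | hitSeq V (2 * R) u v k ω ≠ ⊤} := fun k => by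
      have h : {ω | hitSeq V (2 * R) u v k ω ≠ ⊤} = {ω | hitSeq V (2 * R) u v k ω ≤ v} :=
        Set.ext fun ω => hitSeq_ne_top_iff huv
      rw [h]
      exact F.le v _ (isStoppingTime_hitSeq hcomplete hadapted hrcll hv _ k v)
    have hind : ∀ k, Measurable ({ω | hitSeq V (2 * R) u v k ω ≠ ⊤}.indicator (1 : Ω → ℝ≥0∞)) :=
      fun k => measurable_one.indicator (hB k)
    calc ∫⁻ ω in A, maxOsc V u v ω ^ (p + 1) ∂P
        ≤ ∫⁻ ω in A, ((p + 1).factorial : ℝ≥0∞) * ENNReal.ofReal (4 * R) ^ (p + 1) *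
            ∑' k : ℕ, ((k + p).choose p : ℝ≥0∞) *
              {ω | hitSeq V (2 * R) u v k ω ≠ ⊤}.indicator 1 ω ∂P := by
          refine lintegral_mono_ae (ae_restrict_of_ae ?_)
          filter_upwards [hrcll] with ω hω using maxOsc_pow_le hR huv hv hω p
      _ = ((p + 1).factorial : ℝ≥0∞) * ENNReal.ofReal (4 * R) ^ (p + 1) *
            ∑' k : ℕ, ((k + p).choose p : ℝ≥0∞) *
              P (A ∩ {ω | hitSeq V (2 * R) u v k ω ≠ ⊤}) := by
          rw [lintegral_const_mul _ (Measurable.tsum fun k => (hind k).const_mul _),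
            lintegral_tsum fun k => ((hind k).const_mul _).aemeasurable]
          congr 1
          refine tsum_congr fun k => ?_
          rw [lintegral_const_mul _ (hind k), lintegral_indicator_one (hB k),
            Measure.restrict_apply (hB k), Set.inter_comm]
      _ ≤ ((p + 1).factorial : ℝ≥0∞) * ENNReal.ofReal (4 * R) ^ (p + 1) *
            ∑' k : ℕ, ((k + p).choose p : ℝ≥0∞) * (2⁻¹ ^ k * P A) := by
          gcongr with k
          exact measure_hitSeq_ne_top_le hcomplete hadapted hrcll huv hv hR hrho hA k
      _ = ((p + 1).factorial : ℝ≥0∞) * ENNReal.ofReal (8 * R) ^ (p + 1) * P A := by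
          simp_rw [← mul_assoc]
          rw [ENNReal.tsum_mul_right, tsum_choose_mul_half_pow,
            show 8 * R = (4 * R) * 2 by ring, ENNReal.ofReal_mul (by positivity) (q := 2),
            ENNReal.ofReal_ofNat, mul_pow]
          ring

/-! ### Conditional bounds and exponential moments -/

theorem essSup_condLExp_le [IsFiniteMeasure P] {m' : MeasurableSpace Ω} (hm : m' ≤ m)
    {X : Ω → ℝ≥0∞} {C : ℝ≥0∞}
    (h : ∀ A, MeasurableSet[m'] A → ∫⁻ ω in A, X ω ∂P ≤ C * P A) :
    essSup (condLExp m' P X) P ≤ C := by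
  refine essSup_le_of_ae_le C (ae_le_of_ae_le_trim (hm := hm) ?_)
  refine ae_le_of_forall_setLIntegral_le_of_sigmaFinite (μ := P.trim hm)
    (measurable_condLExp m' P X) fun s hs _ => ?_
  rw [setLIntegral_condLExp_trim hm _ _ hs, setLIntegral_const, trim_measurableSet_eq hm hs]
  exact h s hs

theorem rho_mono {s s' t t' : ℝ≥0} (hs : s ≤ s') (ht : t' ≤ t) :
    rho P F V s' t' ≤ rho P F V s t := by
  refine iSup_mono fun S => iSup_mono fun T => iSup_mono fun hS => iSup_mono fun hT =>
    iSup_mono' fun h => ⟨fun ω => ⟨?_, (h ω).2.1, ?_⟩, le_rfl⟩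
  · exact (WithTop.coe_le_coe.2 hs).trans (h ω).1
  · exact (h ω).2.2.trans (WithTop.coe_le_coe.2 ht)

/-- This is `E[XY] = E[X E[Y | m']] ≤ C E[X]`, obtained by comparing the measures `Y·P` and `C·P` on
`m'`. -/
theorem lintegral_mul_le_of_setLIntegral_le {m' : MeasurableSpace Ω} (hm : m' ≤ m)
    {X Y : Ω → ℝ≥0∞} (hX : Measurable[m'] X) (hY : Measurable[m] Y) {C : ℝ≥0∞}
    (h : ∀ A, MeasurableSet[m'] A → ∫⁻ ω in A, Y ω ∂P ≤ C * P A) :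
    ∫⁻ ω, X ω * Y ω ∂P ≤ C * ∫⁻ ω, X ω ∂P := by
  have hle : (P.withDensity Y).trim hm ≤ (C • P).trim hm := by
    refine @Measure.le_iff _ m' _ _ |>.2 fun s hs => ?_
    rw [trim_measurableSet_eq hm hs, trim_measurableSet_eq hm hs, withDensity_apply _ (hm s hs)]
    exact h s hs
  calc ∫⁻ ω, X ω * Y ω ∂P = ∫⁻ ω, X ω ∂(P.withDensity Y) := by
        rw [lintegral_withDensity_eq_lintegral_mul _ hY
          (@Measurable.mono _ _ m' m _ _ _ hX hm le_rfl)]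
        exact lintegral_congr fun ω => mul_comm _ _
    _ = ∫⁻ ω, X ω ∂((P.withDensity Y).trim hm) := (lintegral_trim hm hX).symm
    _ ≤ ∫⁻ ω, X ω ∂((C • P).trim hm) := lintegral_mono' hle le_rfl
    _ = C * ∫⁻ ω, X ω ∂P := by rw [lintegral_trim hm hX, lintegral_smul_measure, smul_eq_mul]

/-- `exp (l * sup_{u ≤ t ≤ v} |V_t - V_u|)`. -/
noncomputable def expOsc (V : ℝ≥0 → Ω → ℝ) (l : ℝ) (u v : ℝ≥0) (ω : Ω) : ℝ≥0∞ :=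
  ENNReal.ofReal (Real.exp (l * (maxOsc V u v ω).toReal))

theorem ofReal_exp_mul_toReal {l : ℝ} (hl : 0 ≤ l) {x : ℝ≥0∞} (hx : x ≠ ⊤) :
    ENNReal.ofReal (Real.exp (l * x.toReal)) =
      ∑' p : ℕ, ENNReal.ofReal (l ^ p / p.factorial) * x ^ p := by
  have h := NormedSpace.expSeries_div_hasSum_exp (l * x.toReal)
  rw [← Real.exp_eq_exp_ℝ] at h
  rw [← h.tsum_eq, ENNReal.ofReal_tsum_of_nonneg (fun n => by positivity) h.summable]
  refine tsum_congr fun p => ?_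
  rw [mul_pow, mul_div_right_comm, ENNReal.ofReal_mul (by positivity),
    ENNReal.ofReal_pow ENNReal.toReal_nonneg, ENNReal.ofReal_toReal hx]

theorem maxOsc_self (u : ℝ≥0) (ω : Ω) : maxOsc V u u ω = 0 := by
  simp [maxOsc]

theorem maxOsc_le_add {u v w : ℝ≥0} (huv : u ≤ v) (ω : Ω) :
    maxOsc V u w ω ≤ maxOsc V u v ω + maxOsc V v w ω := by
  refine iSup₂_le fun t ht => ?_
  have hu : ∀ s, u ≤ s → s ≤ v → ENNReal.ofReal |V s ω - V u ω| ≤ maxOsc V u v ω :=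
    fun s h1 h2 => le_iSup₂_of_le s ⟨h1, h2⟩ le_rfl
  rcases le_total t v with htv | hvt
  · exact (hu t ht.1 htv).trans le_self_add
  · have h2 : ENNReal.ofReal |V t ω - V v ω| ≤ maxOsc V v w ω :=
      le_iSup₂_of_le (f := fun t _ => ENNReal.ofReal |V t ω - V v ω|) t ⟨hvt, ht.2⟩ le_rfl
    calc ENNReal.ofReal |V t ω - V u ω|
        ≤ ENNReal.ofReal (|V v ω - V u ω| + |V t ω - V v ω|) := by
          refine ENNReal.ofReal_le_ofReal ?_
          rw [add_comm]
          exact abs_sub_le _ _ _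
      _ = ENNReal.ofReal |V v ω - V u ω| + ENNReal.ofReal |V t ω - V v ω| :=
          ENNReal.ofReal_add (abs_nonneg _) (abs_nonneg _)
      _ ≤ _ := add_le_add (hu v huv le_rfl) h2

/-- The first moment bound gives finiteness. It is needed because `expOsc` goes through `toReal`,
which sends `⊤` to 0. -/
theorem ae_maxOsc_ne_top [IsFiniteMeasure P] [F.IsRightContinuous]
    (hcomplete : ∀ N : Set Ω, P N = 0 → MeasurableSet[F 0] N)
    (hadapted : ∀ t, t ≤ τ → Measurable[F t] (V t))
    (hrcll : ∀ᵐ ω ∂P, IsRCLLOn τ (fun t => V t ω)) {u v : ℝ≥0} (huv : u ≤ v) (hv : v ≤ τ)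
    (hrho : rho P F V u v < ⊤) : ∀ᵐ ω ∂P, maxOsc V u v ω ≠ ⊤ := by
  have hR : rho P F V u v ≤ ENNReal.ofReal ((rho P F V u v).toReal + 1) := by
    rw [ENNReal.le_ofReal_iff_toReal_le hrho.ne (by positivity)]
    linarith
  have h := setLIntegral_maxOsc_pow_le hcomplete hadapted hrcll huv hv (by positivity) hR
    MeasurableSet.univ 1
  simp only [pow_one, Measure.restrict_univ] at h
  have hM : Measurable (maxOsc V u v) :=
    (measurable_maxOsc hcomplete hadapted hrcll hv).mono (F.le v) le_rfl
  refine (ae_lt_top hM (ne_top_of_le_ne_top ?_ h)).mono fun ω hω => hω.ne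
  exact ENNReal.mul_ne_top (ENNReal.mul_ne_top (ENNReal.natCast_ne_top _) ENNReal.ofReal_ne_top)
    (measure_ne_top _ _)

theorem measurable_expOsc
    (hcomplete : ∀ N : Set Ω, P N = 0 → MeasurableSet[F 0] N)
    (hadapted : ∀ t, t ≤ τ → Measurable[F t] (V t))
    (hrcll : ∀ᵐ ω ∂P, IsRCLLOn τ (fun t => V t ω)) (l : ℝ) {u v : ℝ≥0} (hv : v ≤ τ) :
    Measurable[F v] (expOsc V l u v) := by
  have h : Measurable fun x : ℝ≥0∞ => ENNReal.ofReal (Real.exp (l * x.toReal)) := by fun_prop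
  exact h.comp (measurable_maxOsc hcomplete hadapted hrcll hv)

theorem setLIntegral_expOsc_le [IsFiniteMeasure P] [F.IsRightContinuous]
    (hcomplete : ∀ N : Set Ω, P N = 0 → MeasurableSet[F 0] N)
    (hadapted : ∀ t, t ≤ τ → Measurable[F t] (V t))
    (hrcll : ∀ᵐ ω ∂P, IsRCLLOn τ (fun t => V t ω)) {u v : ℝ≥0} (huv : u ≤ v) (hv : v ≤ τ)
    {R : ℝ} (hR : 0 < R) (hrho : rho P F V u v ≤ ENNReal.ofReal R) {l : ℝ} (hl : 0 ≤ l)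
    {A : Set Ω} (hA : MeasurableSet[F u] A) :
    ∫⁻ ω in A, expOsc V l u v ω ∂P ≤ (1 - ENNReal.ofReal (l * (8 * R)))⁻¹ * P A := by
  have hM : Measurable (maxOsc V u v) :=
    (measurable_maxOsc hcomplete hadapted hrcll hv).mono (F.le v) le_rfl
  have hfin := ae_maxOsc_ne_top hcomplete hadapted hrcll huv hv
    (hrho.trans_lt ENNReal.ofReal_lt_top)
  calc ∫⁻ ω in A, expOsc V l u v ω ∂P
      = ∫⁻ ω in A, ∑' p : ℕ, ENNReal.ofReal (l ^ p / p.factorial) * maxOsc V u v ω ^ p ∂P :=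
        lintegral_congr_ae (ae_restrict_of_ae
          (hfin.mono fun ω hω => ofReal_exp_mul_toReal hl hω))
    _ = ∑' p : ℕ, ENNReal.ofReal (l ^ p / p.factorial) * ∫⁻ ω in A, maxOsc V u v ω ^ p ∂P := by
        rw [lintegral_tsum fun p => ((hM.pow_const p).const_mul _).aemeasurable]
        exact tsum_congr fun p => lintegral_const_mul _ (hM.pow_const p)
    _ ≤ ∑' p : ℕ, ENNReal.ofReal (l * (8 * R)) ^ p * P A := by
        refine ENNReal.tsum_le_tsum fun p => ?_
        refine (mul_le_mul_right (setLIntegral_maxOsc_pow_le hcomplete hadapted hrcll huv hv hR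
          hrho hA p) _).trans_eq ?_
        rw [← mul_assoc, ← ENNReal.ofReal_natCast, ← ENNReal.ofReal_pow (by positivity),
          ← ENNReal.ofReal_mul (by positivity), ← ENNReal.ofReal_mul (by positivity),
          ← ENNReal.ofReal_pow (by positivity), mul_pow l, ← mul_assoc,
          div_mul_cancel₀ _ (by positivity)]
    _ = _ := by rw [ENNReal.tsum_mul_right, ENNReal.tsum_geometric]

/-- Induction on the number of pieces of length at most `h`: the last piece is conditioned on its
left endpoint and contributes the factor `(1 - 8lR)⁻¹`. The constant depends on `n`, but only its
finiteness matters. -/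
theorem exists_setLIntegral_expOsc_le [IsFiniteMeasure P] [F.IsRightContinuous]
    (hcomplete : ∀ N : Set Ω, P N = 0 → MeasurableSet[F 0] N)
    (hadapted : ∀ t, t ≤ τ → Measurable[F t] (V t))
    (hrcll : ∀ᵐ ω ∂P, IsRCLLOn τ (fun t => V t ω)) {r : ℝ≥0} (hrho : rho P F V r τ < ⊤)
    {R : ℝ} (hR : 0 < R) {h : ℝ≥0}
    (hscale : rhoScale P F V r τ h ≤ ENNReal.ofReal R) {l : ℝ} (hl : 0 ≤ l)
    (hlR : l * (8 * R) < 1) (n : ℕ) {w : ℝ≥0} (hrw : r ≤ w) (hw : w ≤ τ) (hwn : w ≤ r + n * h) :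
    ∃ C : ℝ≥0∞, C ≠ ⊤ ∧ ∀ A, MeasurableSet[F r] A → ∫⁻ ω in A, expOsc V l r w ω ∂P ≤ C * P A := by
  induction n generalizing w with
  | zero =>
    obtain rfl : w = r := le_antisymm (by simpa using hwn) hrw
    refine ⟨1, ENNReal.one_ne_top, fun A _ => ?_⟩
    simp [expOsc, maxOsc_self]
  | succ n ih =>
    -- One step of length `h` back from `w`, stopped at `r`.
    set v := max r (w - h) with hv
    have hvw : v ≤ w := max_le hrw tsub_le_self
    have hrv : r ≤ v := le_max_left _ _
    have hvn : v ≤ r + n * h := by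
      refine max_le le_self_add (tsub_le_iff_right.2 (hwn.trans_eq ?_))
      push_cast
      ring
    have hwv : w - v ≤ h := by
      refine tsub_le_iff_left.2 ?_
      have := tsub_le_iff_right.1 (le_max_right r (w - h))
      exact this
    obtain ⟨C, hC, hCA⟩ := ih hrv (hvw.trans hw) hvn
    refine ⟨(1 - ENNReal.ofReal (l * (8 * R)))⁻¹ * C, ENNReal.mul_ne_top ?_ hC, fun A hA => ?_⟩
    · rw [ENNReal.inv_ne_top, ne_eq, tsub_eq_zero_iff_le, not_le]
      exact ENNReal.ofReal_lt_one.2 hlR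
    have hrho' : rho P F V v w ≤ ENNReal.ofReal R := by
      refine le_trans ?_ hscale
      exact le_iSup_of_le v (le_iSup_of_le w (le_iSup_of_le ⟨hrv, hvw, hw, hwv⟩ le_rfl))
    have hX := measurable_expOsc (u := r) hcomplete hadapted hrcll l (hvw.trans hw)
    have hY := (measurable_expOsc (u := v) hcomplete hadapted hrcll l hw).mono (F.le w) le_rfl
    have hAv : MeasurableSet[F v] A := F.mono hrv _ hA
    have hf1 := ae_maxOsc_ne_top hcomplete hadapted hrcll hrv (hvw.trans hw)
      ((rho_mono le_rfl (hvw.trans hw)).trans_lt hrho)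
    have hf2 := ae_maxOsc_ne_top hcomplete hadapted hrcll hvw hw
      ((rho_mono hrv hw).trans_lt hrho)
    have hAm := F.le v _ hAv
    calc ∫⁻ ω in A, expOsc V l r w ω ∂P
        ≤ ∫⁻ ω in A, expOsc V l r v ω * expOsc V l v w ω ∂P := by
          refine lintegral_mono_ae (ae_restrict_of_ae ?_)
          filter_upwards [hf1, hf2] with ω h1 h2
          rw [expOsc, expOsc, expOsc, ← ENNReal.ofReal_mul (Real.exp_pos _).le, ← Real.exp_add,
            ← mul_add, ← ENNReal.toReal_add h1 h2]
          refine ENNReal.ofReal_le_ofReal (Real.exp_le_exp.2 (mul_le_mul_of_nonneg_left ?_ hl))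
          exact ENNReal.toReal_mono (ENNReal.add_ne_top.2 ⟨h1, h2⟩) (maxOsc_le_add hrv ω)
      _ = ∫⁻ ω, A.indicator (expOsc V l r v) ω * expOsc V l v w ω ∂P := by
          rw [← lintegral_indicator hAm]
          refine lintegral_congr fun ω => ?_
          by_cases hω : ω ∈ A <;> simp [hω]
      _ ≤ (1 - ENNReal.ofReal (l * (8 * R)))⁻¹ * ∫⁻ ω, A.indicator (expOsc V l r v) ω ∂P :=
          lintegral_mul_le_of_setLIntegral_le (F.le v) (hX.indicator hAv) hY fun B hB =>
            setLIntegral_expOsc_le hcomplete hadapted hrcll hvw hw hR hrho' hl hB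
      _ ≤ (1 - ENNReal.ofReal (l * (8 * R)))⁻¹ * (C * P A) := by
          rw [lintegral_indicator hAm]
          exact mul_le_mul_right (hCA A hA) _
      _ = _ := (mul_assoc _ _ _).symm

/-! ### The two conditional estimates -/

theorem essSup_condLExp_iSup_pow_le [IsFiniteMeasure P] [F.IsRightContinuous]
    (hcomplete : ∀ N : Set Ω, P N = 0 → MeasurableSet[F 0] N)
    (hadapted : ∀ t, t ≤ τ → Measurable[F t] (V t))
    (hrcll : ∀ᵐ ω ∂P, IsRCLLOn τ (fun t => V t ω)) {r : ℝ≥0} (hr : r ≤ τ)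
    (hrho : rho P F V r τ < ⊤) (p : ℕ) :
    essSup (condLExp (F r) P
        (fun ω => ⨆ t ∈ Set.Icc r τ, ENNReal.ofReal (|V t ω - V r ω| ^ p))) P
      ≤ (p.factorial : ℝ≥0∞) * (8 * rho P F V r τ) ^ p := by
  have key : ∀ R : ℝ≥0, rho P F V r τ < R → essSup (condLExp (F r) P
      (fun ω => ⨆ t ∈ Set.Icc r τ, ENNReal.ofReal (|V t ω - V r ω| ^ p))) P
      ≤ (p.factorial : ℝ≥0∞) * (8 * R) ^ p := fun R hR => by
    refine essSup_condLExp_le (F.le r) fun A hA => ?_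
    have hR0 : (0 : ℝ) < R := by
      have : (0 : ℝ≥0∞) < R := zero_le.trans_lt hR
      exact_mod_cast this
    have h := setLIntegral_maxOsc_pow_le hcomplete hadapted hrcll hr le_rfl hR0
      (by rw [ENNReal.ofReal_coe_nnreal]; exact hR.le) hA p
    rw [ENNReal.ofReal_mul (by norm_num), ENNReal.ofReal_coe_nnreal, ENNReal.ofReal_ofNat] at h
    refine (lintegral_mono fun ω => ?_).trans h
    refine iSup₂_le fun t ht => ?_
    rw [ENNReal.ofReal_pow (abs_nonneg _)]
    exact pow_le_pow_left' (le_iSup₂_of_le (f := fun t _ => ENNReal.ofReal |V t ω - V r ω|)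
      t ht le_rfl) p
  -- The moment bound needs `R > 0`, whereas `ρ` may vanish, so `R` decreases to `ρ`.
  lift rho P F V r τ to ℝ≥0 using hrho.ne with ρ
  have hcont : Tendsto (fun R : ℝ≥0 => (p.factorial : ℝ≥0∞) * (8 * (R : ℝ≥0∞)) ^ p) (𝓝[>] ρ)
      (𝓝 ((p.factorial : ℝ≥0∞) * (8 * (ρ : ℝ≥0∞)) ^ p)) := by
    have hc : Continuous fun R : ℝ≥0 => (((p.factorial : ℝ≥0) * (8 * R) ^ p : ℝ≥0) : ℝ≥0∞) :=
      ENNReal.continuous_coe.comp (by fun_prop)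
    have := (hc.tendsto ρ).mono_left (nhdsWithin_le_nhds (s := Set.Ioi ρ))
    push_cast at this
    exact this
  refine ge_of_tendsto hcont ?_
  filter_upwards [self_mem_nhdsWithin] with R hR
  exact key R (ENNReal.coe_lt_coe.2 hR)

theorem exp_mul_iSup_eq_expOsc {l : ℝ} {u v : ℝ≥0} (huv : u ≤ v) {ω : Ω}
    (h : maxOsc V u v ω ≠ ⊤) :
    EReal.exp ((l : EReal) * ⨆ t ∈ Set.Icc u v, ((|V t ω - V u ω| : ℝ) : EReal)) =
      expOsc V l u v ω := by
  have hsup : (⨆ t ∈ Set.Icc u v, ((|V t ω - V u ω| : ℝ) : EReal)) =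
      (((maxOsc V u v ω).toReal : ℝ) : EReal) := by
    refine le_antisymm (iSup₂_le fun t ht => EReal.coe_le_coe_iff.2 ?_) ?_
    · rw [← ENNReal.ofReal_le_iff_le_toReal h]
      exact le_iSup₂_of_le (f := fun t _ => ENNReal.ofReal |V t ω - V u ω|) t ht le_rfl
    · set M := ⨆ t ∈ Set.Icc u v, ((|V t ω - V u ω| : ℝ) : EReal) with hM
      have hle : ∀ t ∈ Set.Icc u v, ((|V t ω - V u ω| : ℝ) : EReal) ≤ M := fun t ht =>
        le_iSup₂_of_le (f := fun t _ => ((|V t ω - V u ω| : ℝ) : EReal)) t ht le_rfl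
      have h0 : (0 : EReal) ≤ M := by simpa using hle u ⟨le_rfl, huv⟩
      clear_value M
      induction M with
      | bot => simp at h0
      | top => exact le_top
      | coe x =>
        have hx : 0 ≤ x := EReal.coe_nonneg.1 h0
        refine EReal.coe_le_coe_iff.2 (ENNReal.toReal_le_of_le_ofReal hx ?_)
        exact iSup₂_le fun t ht => ENNReal.ofReal_le_ofReal (EReal.coe_le_coe_iff.1 (hle t ht))
  rw [hsup, ← EReal.coe_mul, EReal.exp_coe, expOsc]

theorem essSup_condLExp_exp_lt_top [IsFiniteMeasure P] [F.IsRightContinuous]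
    (hcomplete : ∀ N : Set Ω, P N = 0 → MeasurableSet[F 0] N)
    (hadapted : ∀ t, t ≤ τ → Measurable[F t] (V t))
    (hrcll : ∀ᵐ ω ∂P, IsRCLLOn τ (fun t => V t ω)) {r : ℝ≥0} (hr : r ≤ τ)
    (hrho : rho P F V r τ < ⊤) {l : ℝ}
    (hl : ENNReal.ofReal l < (8 * kappa P F V r τ)⁻¹) :
    essSup (condLExp (F r) P (fun ω => EReal.exp ((l : EReal) *
      ⨆ t ∈ Set.Icc r τ, ((|V t ω - V r ω| : ℝ) : EReal)))) P < ⊤ := by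
  have hfin := ae_maxOsc_ne_top hcomplete hadapted hrcll hr le_rfl hrho
  suffices h : ∃ C : ℝ≥0∞, C ≠ ⊤ ∧
      ∀ A, MeasurableSet[F r] A → ∫⁻ ω in A, expOsc V l r τ ω ∂P ≤ C * P A by
    obtain ⟨C, hC, hCA⟩ := h
    refine lt_of_le_of_lt (essSup_condLExp_le (F.le r) fun A hA => ?_) (lt_top_iff_ne_top.2 hC)
    refine le_trans (le_of_eq ?_) (hCA A hA)
    exact lintegral_congr_ae (ae_restrict_of_ae
      (hfin.mono fun ω hω => exp_mul_iSup_eq_expOsc hr hω))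
  rcases le_or_gt l 0 with hl0 | hl0
  · refine ⟨1, ENNReal.one_ne_top, fun A _ => ?_⟩
    rw [← setLIntegral_const]
    refine lintegral_mono fun ω => ?_
    rw [expOsc, ENNReal.ofReal_le_one, Real.exp_le_one_iff]
    exact mul_nonpos_of_nonpos_of_nonneg hl0 ENNReal.toReal_nonneg
  -- Since `κ < 1/(8l)`, some scale `h` has its supremum of `ρ` below an `R` with `8lR < 1`; about
  -- `τ/h` pieces then cover `[r, τ]`.
  · have hk : kappa P F V r τ < ENNReal.ofReal (8 * l)⁻¹ := by
      rw [ENNReal.lt_inv_iff_lt_inv] at hl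
      by_contra! hge
      refine absurd (mul_le_mul_right hge 8) (not_le.2 (hl.trans_eq ?_))
      rw [← ENNReal.ofReal_inv_of_pos hl0, ← ENNReal.ofReal_ofNat 8,
        ← ENNReal.ofReal_mul (by norm_num), mul_inv, mul_inv_cancel_left₀ (by norm_num)]
    obtain ⟨h, hh⟩ := iInf_lt_iff.1 hk
    obtain ⟨hh0, hh⟩ := iInf_lt_iff.1 hh
    obtain ⟨R, -, hR1, hR2⟩ := ENNReal.lt_iff_exists_real_btwn.1 hh
    have hR0 : 0 < R := ENNReal.ofReal_pos.1 (zero_le.trans_lt hR1)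
    have hlR : l * (8 * R) < 1 := by
      have h1 := (ENNReal.ofReal_lt_ofReal_iff (by positivity)).1 hR2
      have h2 := (lt_inv_mul_iff₀ (b := (1 : ℝ)) (show 0 < 8 * l by positivity)).1
        (by simpa using h1)
      linarith
    obtain ⟨n, hn⟩ := exists_nat_ge (τ / h)
    refine exists_setLIntegral_expOsc_le hcomplete hadapted hrcll hrho hR0 hR1.le hl0.le hlR n hr
      le_rfl ?_
    exact ((div_le_iff₀ hh0).1 hn).trans le_add_self

end BMOProcess

theorem mainTheorem1 {Ω : Type*} {m : MeasurableSpace Ω} (P : Measure Ω) [IsProbabilityMeasure P]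
    (F : Filtration ℝ≥0 m) [F.IsRightContinuous]
    (hcomplete : ∀ N : Set Ω, P N = 0 → MeasurableSet[F 0] N)
    (τ : ℝ≥0) (hτ : 0 < τ) (V : ℝ≥0 → Ω → ℝ) (hV : BMOProcess.IsBMO P F τ V)
    (r : ℝ≥0) (hr : r ≤ τ) :
    (∀ p : ℕ, 1 ≤ p →
      essSup (condLExp (F r) P
        (fun ω => ⨆ t ∈ Set.Icc r τ, ENNReal.ofReal (|V t ω - V r ω| ^ p))) P
        ≤ (p.factorial : ℝ≥0∞) * (11 * BMOProcess.rho P F V r τ) ^ p) ∧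
    (∀ l : ℝ, ENNReal.ofReal l < (11 * BMOProcess.kappa P F V r τ)⁻¹ →
      essSup (condLExp (F r) P
        (fun ω => EReal.exp ((l : EReal) *
          ⨆ t ∈ Set.Icc r τ, ((|V t ω - V r ω| : ℝ) : EReal)))) P < ∞) := by
  have hrho : BMOProcess.rho P F V r τ < ⊤ :=
    (BMOProcess.rho_mono zero_le le_rfl).trans_lt hV.bounded
  have h8 : (8 : ℝ≥0∞) ≤ 11 := by norm_num
  refine ⟨fun p _ => ?_, fun l hl => ?_⟩
  · refine (BMOProcess.essSup_condLExp_iSup_pow_le hcomplete hV.adapted hV.rcll hr hrho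
      p).trans ?_
    gcongr
  · refine BMOProcess.essSup_condLExp_exp_lt_top hcomplete hV.adapted hV.rcll hr hrho
      (hl.trans_le ?_)
    rw [ENNReal.inv_le_inv]
    gcongr
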